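/- Let $n\ge 2$. The unrestricted virtual braid group $UVB_n$ is the group with generators $\sigma_1,\dots,\sigma_{n-1},\rho_1,\dots,\rho_{n-1}$ and the following relations, for all admissible indices: $$\sigma_i\sigma_{i+1}\sigma_i=\sigma_{i+1}\sigma_i\sigma_{i+1},\quad \rho_i\rho_{i+1}\rho_i=\rho_{i+1}\rho_i\rho_{i+1},\quad \rho_i^2=1,\quad \rho_i\rho_{i+1}\sigma_i=\sigma_{i+1}\rho_i\rho_{i+1},$$ $$\rho_i\sigma_{i+1}\sigma_i=\sigma_{i+1}\sigma_i\rho_{i+1},\quad \rho_{i+1}\sigma_i\sigma_{i+1}=\sigma_i\sigma_{i+1}\rho_i,$$ $$\sigma_i\sigma_j=\sigma_j\sigma_i,\quad \rho_i\rho_j=\rho_j\rho_i,\quad \sigma_i\rho_j=\rho_j\sigma_i\quad\text{if } |i-j|\ge 2.$$ Let $UVP_n$ be the kernel of the homomorphism $UVB_n\to S_n$ that sends $\sigma_i$ and $\rho_i$ to the transposition $(i\ \ i+1)$. Put $\lambda_{n-1,n}=\rho_{n-1}\sigma_{n-1}^{-1}$, $\lambda_{n,n-1}=\rho_{n-1}\lambda_{n-1,n}\rho_{n-1}=\sigma_{n-1}^{-1}\rho_{n-1}$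 and $[u,v]=u^{-1}v^{-1}uv$. An oriented fused link diagram is a generic immersion of finitely many oriented circles in the plane whose double points are marked as classical (with over/under information) or virtual. Two such diagrams are equivalent as fused links if they are related by a finite sequence of ambient isotopies of the plane, classical, virtual and mixed Reidemeister moves, and both forbidden moves (a strand that passes over two other strands, or under two other strands, may be moved across a virtual crossing of these two). The closure of a braid is the diagram obtained by drawing a word that represents the braid, with a classical crossing of one type for each $\sigma_i$, of the other type for each $\sigma_i^{-1}$, and a virtual crossing for each $\rho_i$, and joining the corresponding ends by parallel arcs. Let $\alpha\in UVP_n$ and let $u,v$ be elements of the subgroup $\langle\lambda_{n-1,n},\lambda_{n,n-1}\rangle$ of $UVB_n$. Then the closures of $\alpha$ and of $\alpha[u,v]$ are equivalent fused links (for any choice of words representing the two braids). -/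

import Mathlib

namespace FusedLinks

/-! ### The unrestricted virtual braid group

Indices are shifted by one: the value `i : Fin (n - 1)` stands for the paper's index `i + 1`, so
that `sigma i` exchanges the strands `i` and `i + 1` of the `n` strands `0, ..., n - 1`. -/

/-- The generators of the unrestricted virtual braid group on `n` strands. -/
inductive Gen (n : ℕ) : Type
  | sigma (i : Fin (n - 1)) : Gen n
  | rho (i : Fin (n - 1)) : Gen n

/-- The generator `sigma_i` of the free group. -/
def fs {n : ℕ} (i : Fin (n - 1)) : FreeGroup (Gen n) := FreeGroup.of (Gen.sigma i)

/-- The generator `rho_i` of the free group. -/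
def fr {n : ℕ} (i : Fin (n - 1)) : FreeGroup (Gen n) := FreeGroup.of (Gen.rho i)

/-- `|i - j| ≥ 2`. -/
def Far {m : ℕ} (i j : Fin m) : Prop := i.val + 2 ≤ j.val ∨ j.val + 2 ≤ i.val

/-- The defining relations of the unrestricted virtual braid group; `j` is the successor of `i`
wherever `i.val + 1 = j.val` is required. -/
inductive BraidRel (n : ℕ) : FreeGroup (Gen n) → FreeGroup (Gen n) → Prop
  | b1 (i j : Fin (n - 1)) (h : i.val + 1 = j.val) :
      BraidRel n (fs i * fs j * fs i) (fs j * fs i * fs j)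
  | b2 (i j : Fin (n - 1)) (h : Far i j) : BraidRel n (fs i * fs j) (fs j * fs i)
  | p1 (i j : Fin (n - 1)) (h : i.val + 1 = j.val) :
      BraidRel n (fr i * fr j * fr i) (fr j * fr i * fr j)
  | p2 (i j : Fin (n - 1)) (h : Far i j) : BraidRel n (fr i * fr j) (fr j * fr i)
  | p3 (i : Fin (n - 1)) : BraidRel n (fr i * fr i) 1
  | m1 (i j : Fin (n - 1)) (h : Far i j) : BraidRel n (fs i * fr j) (fr j * fs i)
  | m2 (i j : Fin (n - 1)) (h : i.val + 1 = j.val) :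
      BraidRel n (fr i * fr j * fs i) (fs j * fr i * fr j)
  | f1 (i j : Fin (n - 1)) (h : i.val + 1 = j.val) :
      BraidRel n (fr i * fs j * fs i) (fs j * fs i * fr j)
  | f2 (i j : Fin (n - 1)) (h : i.val + 1 = j.val) :
      BraidRel n (fr j * fs i * fs j) (fs i * fs j * fr i)

/-- The relators of the unrestricted virtual braid group. -/
def braidRels (n : ℕ) : Set (FreeGroup (Gen n)) :=
  {z | ∃ x y, BraidRel n x y ∧ z = x * y⁻¹}

/-- The unrestricted virtual braid group `UVB_n`. -/
abbrev UVB (n : ℕ) : Type := PresentedGroup (braidRels n)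

/-- The generator `sigma_i` of `UVB_n`. -/
def sigma {n : ℕ} (i : Fin (n - 1)) : UVB n := PresentedGroup.of (Gen.sigma i)

/-- The generator `rho_i` of `UVB_n`. -/
def rho {n : ℕ} (i : Fin (n - 1)) : UVB n := PresentedGroup.of (Gen.rho i)

/-- The transposition of `i` and `i + 1`. -/
def tau {n : ℕ} (i : Fin (n - 1)) : Equiv.Perm (Fin n) :=
  Equiv.swap ⟨i.val, by omega⟩ ⟨i.val + 1, by omega⟩

/-- The permutation assigned to a generator. -/
def genPerm {n : ℕ} : Gen n → Equiv.Perm (Fin n)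
  | Gen.sigma i => tau i
  | Gen.rho i => tau i

theorem tau_sq {n : ℕ} (i : Fin (n - 1)) : tau i * tau i = 1 := by
  simp [tau]

theorem tau_braid {n : ℕ} (i j : Fin (n - 1)) (h : i.val + 1 = j.val) :
    tau i * tau j * tau i = tau j * tau i * tau j := by
  obtain ⟨i, hi⟩ := i
  obtain ⟨j, hj⟩ := j
  simp only at h
  subst h
  simp only [tau]
  have h1 := Equiv.swap_mul_swap_mul_swap (x := (⟨i + 1 + 1, by omega⟩ : Fin n))
    (y := ⟨i + 1, by omega⟩) (z := ⟨i, by omega⟩) (by simp) (by simp [Fin.ext_iff]; omega)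
  have h2 := Equiv.swap_mul_swap_mul_swap (x := (⟨i, by omega⟩ : Fin n))
    (y := ⟨i + 1, by omega⟩) (z := ⟨i + 1 + 1, by omega⟩) (by simp) (by simp [Fin.ext_iff]; omega)
  rw [Equiv.swap_comm (⟨i, _⟩ : Fin n) ⟨i + 1, _⟩,
    Equiv.swap_comm (⟨i + 1, _⟩ : Fin n) ⟨i + 1 + 1, _⟩, h1,
    Equiv.swap_comm (⟨i + 1 + 1, _⟩ : Fin n) ⟨i + 1, _⟩,
    Equiv.swap_comm (⟨i + 1, _⟩ : Fin n) ⟨i, _⟩, h2, Equiv.swap_comm]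

theorem tau_comm {n : ℕ} (i j : Fin (n - 1)) (h : Far i j) : tau i * tau j = tau j * tau i := by
  apply Equiv.Perm.Disjoint.commute
  unfold Far at h
  unfold tau
  apply Equiv.Perm.disjoint_swap_swap
  simp [Fin.ext_iff]
  omega

theorem lift_braidRel {n : ℕ} {x y : FreeGroup (Gen n)} (h : BraidRel n x y) :
    FreeGroup.lift genPerm x = FreeGroup.lift genPerm y := by
  cases h <;> simp only [fs, fr, map_mul, FreeGroup.lift_apply_of, genPerm, map_one]
  case p3 i => exact tau_sq i
  case b2 i j h => exact tau_comm i j h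
  case p2 i j h => exact tau_comm i j h
  case m1 i j h => exact tau_comm i j h
  case f2 i j h => exact (tau_braid i j h).symm
  all_goals exact tau_braid _ _ ‹_›

/-- The homomorphism `UVB_n → S_n` with `sigma_i, rho_i ↦ (i i+1)`. -/
def iota (n : ℕ) : UVB n →* Equiv.Perm (Fin n) :=
  PresentedGroup.toGroup (f := genPerm) (rels := braidRels n) (by
    rintro _ ⟨x, y, h, rfl⟩
    rw [map_mul, map_inv, lift_braidRel h, mul_inv_cancel])

/-- The pure unrestricted virtual braid group `UVP_n`. -/
def UVP (n : ℕ) : Subgroup (UVB n) := (iota n).ker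

/-- `lambda_{i,i+1} = rho_i sigma_i⁻¹`. -/
def lamUp {n : ℕ} (i : Fin (n - 1)) : UVB n := rho i * (sigma i)⁻¹

/-- `lambda_{i+1,i} = rho_i lambda_{i,i+1} rho_i`. -/
def lamDown {n : ℕ} (i : Fin (n - 1)) : UVB n := rho i * lamUp i * rho i

/-! ### Fused link diagrams

An oriented diagram in the plane is put in Morse position with respect to the height and is read
from top to bottom, one elementary piece (a local maximum, a local minimum or a double point)
at a time. A horizontal level is recorded by the orientations of the strands it meets, from left
to right (`true` for downwards). Ambient isotopy of the plane becomes the moves listed in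
`PlanarMove`. -/

/-- The types of a double point: classical, where the strand from upper left to lower right passes
over (`over`) or under (`under`) the other one, or virtual. -/
inductive Crossing : Type
  | over | under | virt

/-- The same double point when the two strands trade their roles, that is, when the strand that
went from upper left to lower right now goes from upper right to lower left. -/
def Crossing.flip : Crossing → Crossing
  | .over => .under
  | .under => .over
  | .virt => .virt

/-- The double point is classical. -/
def Crossing.IsClassical : Crossing → Prop
  | .over => True
  | .under => True
  | .virt => False

/-- Elementary pieces: a local maximum, whose left leg is oriented by `o`; a local minimum;
a double point. -/
inductive Piece : Type
  | top (o : Bool) : Piece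
  | bot : Piece
  | cross (k : Crossing) : Piece

/-- The number of strands that enter a piece from above. -/
def Piece.inArity : Piece → ℕ
  | .top _ => 0
  | .bot => 2
  | .cross _ => 2

/-- The number of strands that leave a piece below. -/
def Piece.outArity : Piece → ℕ
  | .top _ => 2
  | .bot => 0
  | .cross _ => 2

/-- The level below a piece placed at the left end of the level `s`, if the piece fits there. -/
def Piece.act : Piece → List Bool → Option (List Bool)
  | .top o, s => some (o :: (!o) :: s)
  | .bot, a :: b :: s => if b = !a then some s else none
  | .cross _, a :: b :: s => some (b :: a :: s)
  | _, _ => none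

/-- The level below a piece placed to the right of the first `p` strands of a level. -/
def actAt : ℕ → Piece → List Bool → Option (List Bool)
  | 0, g, s => g.act s
  | p + 1, g, a :: s => (actAt p g s).map (fun t => a :: t)
  | _ + 1, _, [] => none

/-- A layer `(p, g)`: the piece `g` with exactly `p` strands to its left. -/
abbrev Layer : Type := ℕ × Piece

/-- The level below a stack of layers, if every layer fits. -/
def run : List Layer → List Bool → Option (List Bool)
  | [], s => some s
  | l :: L, s => (actAt l.1 l.2 s).bind (run L)

/-- An oriented fused link diagram. -/
structure Diagram : Type where
  layers : List Layer
  closed : run layers [] = some []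

/-- Local moves that realize ambient isotopies of the plane. -/
inductive PlanarMove : List Layer → List Layer → Prop
  /-- Two pieces that lie side by side exchange their heights. -/
  | exchange (p r : ℕ) (g h : Piece) :
      PlanarMove [(p, g), (p + g.outArity + r, h)] [(p + g.inArity + r, h), (p, g)]
  /-- A maximum and a minimum next to each other cancel. -/
  | zigzagRight (p : ℕ) (o : Bool) : PlanarMove [(p + 1, .top o), (p, .bot)] []
  | zigzagLeft (p : ℕ) (o : Bool) : PlanarMove [(p, .top o), (p + 1, .bot)] []
  /-- A double point passes from one leg of a minimum to the other. -/
  | pitchforkBot (p : ℕ) (k : Crossing) :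
      PlanarMove [(p, .cross k), (p + 1, .bot)] [(p + 1, .cross k.flip), (p, .bot)]
  /-- A double point passes from one leg of a maximum to the other. -/
  | pitchforkTop (p : ℕ) (o : Bool) (k : Crossing) :
      PlanarMove [(p, .top o), (p + 1, .cross k)] [(p + 1, .top o), (p, .cross k.flip)]

/-- The triples of double points, of the strands 1 and 2, 1 and 3, 2 and 3 (numbered from left to
right at the top), for which the third Reidemeister type move is allowed. -/
inductive TriangleMove : Crossing → Crossing → Crossing → Prop
  /-- The classical move: the three strands are at three different heights, so that neither
  `over, under, over` nor `under, over, under` occurs. -/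
  | classical (a b c : Crossing) (ha : a.IsClassical) (hb : b.IsClassical) (hc : c.IsClassical)
      (h : ¬ (a = c ∧ b = a.flip)) : TriangleMove a b c
  /-- The virtual move. -/
  | virtual : TriangleMove .virt .virt .virt
  /-- The mixed move: a strand with two virtual double points passes a classical one. -/
  | mixed1 (k : Crossing) (hk : k.IsClassical) : TriangleMove .virt .virt k
  | mixed2 (k : Crossing) (hk : k.IsClassical) : TriangleMove .virt k .virt
  | mixed3 (k : Crossing) (hk : k.IsClassical) : TriangleMove k .virt .virt
  /-- The forbidden moves: a strand (1, 2 or 3) that passes over the two others, or under the two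
  others, passes their virtual double point. -/
  | forbidden1 (k : Crossing) (hk : k.IsClassical) : TriangleMove k k .virt
  | forbidden2 (k : Crossing) (hk : k.IsClassical) : TriangleMove k .virt k.flip
  | forbidden3 (k : Crossing) (hk : k.IsClassical) : TriangleMove .virt k k

/-- The generalized Reidemeister moves (classical, virtual, mixed and forbidden). -/
inductive ReidemeisterMove : List Layer → List Layer → Prop
  /-- First moves, classical or virtual: a kink to the right or to the left of a strand. -/
  | oneRight (p : ℕ) (o : Bool) (k : Crossing) :
      ReidemeisterMove [(p + 1, .top o), (p, .cross k), (p + 1, .bot)] []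
  | oneLeft (p : ℕ) (o : Bool) (k : Crossing) :
      ReidemeisterMove [(p, .top o), (p + 1, .cross k), (p, .bot)] []
  /-- Second moves, classical or virtual. -/
  | two (p : ℕ) (k : Crossing) : ReidemeisterMove [(p, .cross k), (p, .cross k.flip)] []
  /-- Third moves, mixed moves and forbidden moves. -/
  | three (p : ℕ) (a b c : Crossing) (h : TriangleMove a b c) :
      ReidemeisterMove [(p, .cross a), (p + 1, .cross b), (p, .cross c)]
        [(p + 1, .cross c), (p, .cross b), (p + 1, .cross a)]

/-- `E` is obtained from `D` by one local move. Both are diagrams, so the strands that the move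
needs are there, with matching orientations. -/
def Step (D E : Diagram) : Prop :=
  ∃ A X Y B : List Layer, (PlanarMove X Y ∨ ReidemeisterMove X Y) ∧
    D.layers = A ++ X ++ B ∧ E.layers = A ++ Y ++ B

/-- Two diagrams are equivalent, that is, they represent the same fused link. -/
def FusedEquivalent (D E : Diagram) : Prop := Relation.EqvGen Step D E

/-! ### Closures of braids -/

/-- Letters of braid diagrams on `n` strands. -/
inductive Letter (n : ℕ) : Type
  | sigma (i : Fin (n - 1)) : Letter n
  | sigmaInv (i : Fin (n - 1)) : Letter n
  | rho (i : Fin (n - 1)) : Letter n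

/-- The element of `UVB_n` given by a letter. -/
def Letter.toUVB {n : ℕ} : Letter n → UVB n
  | .sigma i => FusedLinks.sigma i
  | .sigmaInv i => (FusedLinks.sigma i)⁻¹
  | .rho i => FusedLinks.rho i

/-- The braid represented by a braid diagram, given as a word. -/
def braidOf {n : ℕ} (w : List (Letter n)) : UVB n := (w.map Letter.toUVB).prod

/-- The double point given by a letter. -/
def Letter.layer {n : ℕ} : Letter n → Layer
  | .sigma i => (i.val, .cross .over)
  | .sigmaInv i => (i.val, .cross .under)
  | .rho i => (i.val, .cross .virt)

/-- The layers of the closure of a braid diagram: the `n` strands run downwards, and their ends are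
joined by `n` nested arcs on the right of the braid. -/
def closureLayers {n : ℕ} (w : List (Letter n)) : List Layer :=
  (List.range n).map (fun i => (i, Piece.top true)) ++ w.map Letter.layer ++
    (List.range n).reverse.map (fun i => (i, Piece.bot))

theorem run_append (L M : List Layer) (s : List Bool) :
    run (L ++ M) s = (run L s).bind (run M) := by
  induction L generalizing s with
  | nil => rfl
  | cons l L ih =>
    simp only [List.cons_append, run]
    cases actAt l.1 l.2 s with
    | none => rfl
    | some t => simpa using ih t

theorem actAt_append (u : List Bool) (g : Piece) (s : List Bool) :
    actAt u.length g (u ++ s) = (g.act s).map (fun t => u ++ t) := by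
  induction u with
  | nil => simp [actAt]
  | cons a u ih => simp [actAt, ih, Function.comp_def]

theorem run_tops (n : ℕ) :
    run ((List.range n).map (fun i => (i, Piece.top true))) [] =
      some (List.replicate n true ++ List.replicate n false) := by
  induction n with
  | zero => rfl
  | succ n ih =>
    have h := actAt_append (List.replicate n true) (.top true) (List.replicate n false)
    rw [List.length_replicate] at h
    rw [List.range_succ, List.map_append, run_append, ih]
    simp [run, h, Piece.act, List.replicate_succ' (n := n) (a := true),
      List.replicate_succ (n := n) (a := false)]

theorem run_bots (n : ℕ) :
    run ((List.range n).reverse.map (fun i => (i, Piece.bot)))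
      (List.replicate n true ++ List.replicate n false) = some [] := by
  induction n with
  | zero => rfl
  | succ n ih =>
    have h := actAt_append (List.replicate n true) .bot
      (true :: false :: List.replicate n false)
    rw [List.length_replicate] at h
    rw [List.range_succ, List.reverse_append, List.map_append, run_append,
      List.replicate_succ' (n := n) (a := true), List.replicate_succ (n := n) (a := false)]
    simpa [run, h, Piece.act] using ih

theorem actAt_cross {n : ℕ} (i : Fin (n - 1)) (k : Crossing) (s : List Bool) :
    actAt i.val (.cross k) (List.replicate n true ++ s) = some (List.replicate n true ++ s) := by
  obtain ⟨i, hi⟩ := i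
  obtain ⟨m, rfl⟩ : ∃ m, n = i + (m + 2) := ⟨n - 2 - i, by omega⟩
  have h := actAt_append (List.replicate i true) (.cross k)
    (List.replicate (m + 2) true ++ s)
  rw [List.length_replicate] at h
  rw [List.replicate_add, List.append_assoc, h]
  simp [Piece.act, List.replicate_succ]

theorem run_word {n : ℕ} (w : List (Letter n)) (s : List Bool) :
    run (w.map Letter.layer) (List.replicate n true ++ s) =
      some (List.replicate n true ++ s) := by
  induction w with
  | nil => rfl
  | cons l w ih => cases l <;> simpa [run, Letter.layer, actAt_cross] using ih

/-- The closure of a braid diagram. -/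
def braidClosure {n : ℕ} (w : List (Letter n)) : Diagram where
  layers := closureLayers w
  closed := by
    simp only [closureLayers, run_append, run_tops, run_word, run_bots, Option.bind_some]

/-- Every braid is represented by some braid diagram. -/
theorem exists_braidOf {n : ℕ} (α : UVB n) : ∃ w : List (Letter n), braidOf w = α := by
  have hr : ∀ i : Fin (n - 1), rho i * rho i = (1 : UVB n) := fun i => by
    have h : (QuotientGroup.mk (fr i * fr i * (1 : FreeGroup (Gen n))⁻¹) : UVB n) = 1 :=
      (QuotientGroup.eq_one_iff _).2 (Subgroup.subset_normalClosure ⟨_, _, .p3 i, rfl⟩)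
    rw [inv_one, mul_one] at h
    exact h
  have hm : ∀ v w : List (Letter n), braidOf (v ++ w) = braidOf v * braidOf w := fun v w => by
    simp [braidOf]
  have hα : α ∈ Subgroup.closure (Set.range (PresentedGroup.of (rels := braidRels n))) := by
    simp
  induction hα using Subgroup.closure_induction'' with
  | one => exact ⟨[], rfl⟩
  | mem x hx =>
    obtain ⟨g, rfl⟩ := hx
    cases g with
    | sigma i => exact ⟨[.sigma i], by simp [braidOf, Letter.toUVB, sigma]⟩
    | rho i => exact ⟨[.rho i], by simp [braidOf, Letter.toUVB, rho]⟩
  | inv_mem x hx =>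
    obtain ⟨g, rfl⟩ := hx
    cases g with
    | sigma i => exact ⟨[.sigmaInv i], by simp [braidOf, Letter.toUVB, sigma]⟩
    | rho i =>
      refine ⟨[.rho i], ?_⟩
      simp only [braidOf, Letter.toUVB, List.map_cons, List.map_nil, List.prod_cons, List.prod_nil,
        mul_one]
      exact eq_inv_of_mul_eq_one_left (hr i)
  | mul x y _ _ hx hy =>
    obtain ⟨v, rfl⟩ := hx
    obtain ⟨w, rfl⟩ := hy
    exact ⟨v ++ w, hm v w⟩

/-- The closures of the braids `α` and `β` are equivalent fused links: the closures of any braid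
diagrams that represent them are equivalent. -/
def ClosuresEquivalent {m n : ℕ} (α : UVB m) (β : UVB n) : Prop :=
  ∀ (a : List (Letter m)) (b : List (Letter n)), braidOf a = α → braidOf b = β →
    FusedEquivalent (braidClosure a) (braidClosure b)

end FusedLinks

/-!
The defining relations of `UVB n` are Reidemeister and forbidden moves, so words for the same braid
have equivalent closures, and closures do not change under conjugation and under `α ↦ α ρ` for a
virtual crossing `ρ` with one new strand on the right. Together these moves insert, anywhere in a
braid, the virtual transposition of any of its strands with the new one.

Write `1`, `2` for the last two strands, `3`, `4` for new ones and `∼` for equivalence of closures.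
Since `λ₂₁` and `λ₁₃` commute, as do `λ₁₂` and `λ₂₃`, and also `λ₁₃` and `λ₂₄`,

* `β λ₁₂ λ₂₁ ∼ β λ₁₂ (2 3) λ₂₁ = β (2 3) λ₂₁ λ₁₃ ∼ β (2 3) λ₂₁ (1 4) λ₁₃`;
* conjugation by `(3 4)`, which commutes with `β`, turns the last braid into
  `β (1 3) λ₁₂ (2 4) λ₂₃`;
* `β (1 3) λ₁₂ (2 4) λ₂₃ ∼ β (1 3) λ₁₂ λ₂₃ = β λ₂₁ (1 3) λ₁₂ ∼ β λ₂₁ λ₁₂`.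

Hence `λ₁₂` and `λ₂₁` commute modulo the congruence of factors that may replace each other in every
braid, and so do all elements that they generate. The corresponding elements for other adjacent
strands are conjugate to `λ₁₂` and `λ₂₁` by one common braid.
-/

namespace FusedLinks

/-! ### Stacks of layers -/

/-- Stacks of layers that may replace each other below the level `s`: they lead to the same level,
and the replacement does not change the fused link that any diagram represents. -/
structure StackEquiv (s : List Bool) (X Y : List Layer) : Prop where
  run_eq : run X s = run Y s
  fusedEquivalent (A B : List Layer) (hX : run (A ++ X ++ B) [] = some [])
    (hY : run (A ++ Y ++ B) [] = some []) (hA : run A [] = some s) :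
    FusedEquivalent ⟨A ++ X ++ B, hX⟩ ⟨A ++ Y ++ B, hY⟩

namespace StackEquiv

variable {s : List Bool} {X Y Z : List Layer}

theorem refl (s : List Bool) (X : List Layer) : StackEquiv s X X :=
  ⟨rfl, fun _ _ _ _ _ => .refl _⟩

theorem symm (h : StackEquiv s X Y) : StackEquiv s Y X :=
  ⟨h.run_eq.symm, fun A B hX hY hA => (h.fusedEquivalent A B hY hX hA).symm⟩

theorem trans (h : StackEquiv s X Y) (h' : StackEquiv s Y Z) : StackEquiv s X Z where
  run_eq := h.run_eq.trans h'.run_eq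
  fusedEquivalent A B hX hZ hA := by
    have hY : run (A ++ Y ++ B) [] = some [] := by
      rw [← hX]
      simp only [run_append, hA, Option.bind_some, h.run_eq]
    exact (h.fusedEquivalent A B hX hY hA).trans _ _ _ (h'.fusedEquivalent A B hY hZ hA)

instance : Trans (StackEquiv s) (StackEquiv s) (StackEquiv s) := ⟨trans⟩

theorem append_right (h : StackEquiv s X Y) (Q : List Layer) :
    StackEquiv s (X ++ Q) (Y ++ Q) := by
  refine ⟨by simp only [run_append, h.run_eq], fun A B => ?_⟩
  simp only [← List.append_assoc A, List.append_assoc _ Q B]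
  exact h.fusedEquivalent A (Q ++ B)

theorem append_left (P : List Layer) (h : ∀ t, run P s = some t → StackEquiv t X Y) :
    StackEquiv s (P ++ X) (P ++ Y) := by
  cases hP : run P s with
  | none =>
    refine ⟨by simp only [run_append, hP, Option.bind_none], fun A B hX _ hA => ?_⟩
    simp [run_append, hA, hP] at hX
  | some t =>
    refine ⟨by simp only [run_append, hP, Option.bind_some, (h t hP).run_eq], fun A B => ?_⟩
    simp only [← List.append_assoc A]
    exact fun hX hY hA =>
      (h t hP).fusedEquivalent (A ++ P) B hX hY (by simp [run_append, hA, hP])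

theorem cons (l : Layer) (h : ∀ t, StackEquiv t X Y) : StackEquiv s (l :: X) (l :: Y) :=
  append_left [l] fun t _ => h t

theorem of_move (h : PlanarMove X Y ∨ ReidemeisterMove X Y) (hr : run X s = run Y s) :
    StackEquiv s X Y :=
  ⟨hr, fun A B _ _ _ => .rel _ _ ⟨A, X, Y, B, h, rfl, rfl⟩⟩

theorem fusedEquivalent_of_layers {D E : Diagram} (h : StackEquiv [] D.layers E.layers) :
    FusedEquivalent D E := by
  obtain ⟨D, hD⟩ := D
  obtain ⟨E, hE⟩ := E
  simpa only [List.nil_append, List.append_nil] using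
    h.fusedEquivalent [] [] (by simpa using hD) (by simpa using hE) rfl

end StackEquiv

/-- The stack `L`, moved to the right by `p` strands. -/
def shift (p : ℕ) (L : List Layer) : List Layer := L.map fun l => (p + l.1, l.2)

theorem run_shift_append (u : List Bool) (L : List Layer) (s : List Bool) :
    run (shift u.length L) (u ++ s) = (run L s).map (u ++ ·) := by
  have actAt_add (u : List Bool) (p : ℕ) (g : Piece) (s : List Bool) :
      actAt (u.length + p) g (u ++ s) = (actAt p g s).map (u ++ ·) := by
    induction u with
    | nil => simp
    | cons a u ih => simp [actAt, Nat.succ_add, ih, Function.comp_def]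
  induction L generalizing s with
  | nil => rfl
  | cons l L ih =>
    simp only [shift, List.map_cons, run, actAt_add]
    cases actAt l.1 l.2 s with
    | none => rfl
    | some t => exact ih t

theorem run_shift_of_length_lt {p : ℕ} {L : List Layer} (hL : L ≠ []) {s : List Bool}
    (hs : s.length < p) : run (shift p L) s = none := by
  have actAt_eq_none (q : ℕ) (g : Piece) (s : List Bool) (h : s.length < q) :
      actAt q g s = none := by
    induction q generalizing s with
    | zero => omega
    | succ q ih =>
      cases s with
      | nil => rfl
      | cons a s => simp [actAt, ih s (by simpa using h)]
  obtain ⟨l, L, rfl⟩ := List.exists_cons_of_ne_nil hL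
  simp [shift, run, actAt_eq_none (p + l.1) l.2 s (by omega)]

theorem run_shift_congr {X Y : List Layer} (hX : X ≠ []) (hY : Y ≠ [])
    (h : ∀ s, run X s = run Y s) (p : ℕ) (s : List Bool) :
    run (shift p X) s = run (shift p Y) s := by
  rcases lt_or_ge s.length p with hp | hp
  · rw [run_shift_of_length_lt hX hp, run_shift_of_length_lt hY hp]
  · obtain ⟨u, t, rfl, rfl⟩ : ∃ u t, s = u ++ t ∧ p = u.length :=
      ⟨s.take p, s.drop p, by simp, by simpa using hp⟩
    rw [run_shift_append, run_shift_append, h]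

theorem run_exchange (p r : ℕ) (g h : Piece) (s : List Bool) :
    run [(p, g), (p + g.outArity + r, h)] s = run [(p + g.inArity + r, h), (p, g)] s := by
  have run_zero (s : List Bool) :
      run [(0, g), (g.outArity + r, h)] s = run [(g.inArity + r, h), (0, g)] s := by
    have two_add (t : List Bool) : actAt (2 + r) h t = actAt (r + 1 + 1) h t := by
      rw [add_comm]
    rcases g with o | _ | k
    case top =>
      cases hs : actAt r h s <;>
        simp [run, actAt, Piece.act, Piece.outArity, Piece.inArity, two_add, hs]
    all_goals
      rcases s with _ | ⟨a, _ | ⟨b, s⟩⟩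
      · simp [run, actAt, Piece.act, Piece.inArity, two_add]
      · simp [run, actAt, Piece.act, Piece.inArity, two_add]
      · by_cases hb : b = !a <;> cases hs : actAt r h s <;>
          simp [run, actAt, Piece.act, Piece.outArity, Piece.inArity, two_add, hb, hs]
  simpa only [shift, List.map_cons, List.map_nil, add_zero, ← add_assoc] using
    run_shift_congr (by simp) (by simp) run_zero p s

theorem run_pitchforkBot (p : ℕ) (k k' : Crossing) (s : List Bool) :
    run [(p, .cross k), (p + 1, .bot)] s = run [(p + 1, .cross k'), (p, .bot)] s :=
  run_shift_congr (X := [(0, .cross k), (1, .bot)]) (Y := [(1, .cross k'), (0, .bot)])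
    (by simp) (by simp)
    (fun s => by rcases s with _ | ⟨a, _ | ⟨b, _ | ⟨c, s⟩⟩⟩ <;> simp [run, actAt, Piece.act]) p s

theorem run_pitchforkTop (p : ℕ) (o : Bool) (k k' : Crossing) (s : List Bool) :
    run [(p, .top o), (p + 1, .cross k)] s = run [(p + 1, .top o), (p, .cross k')] s :=
  run_shift_congr (X := [(0, .top o), (1, .cross k)]) (Y := [(1, .top o), (0, .cross k')])
    (by simp) (by simp)
    (fun s => by rcases s with _ | ⟨a, s⟩ <;> simp [run, actAt, Piece.act]) p s

theorem run_three (p : ℕ) (a b c a' b' c' : Crossing) (s : List Bool) :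
    run [(p, .cross a), (p + 1, .cross b), (p, .cross c)] s =
      run [(p + 1, .cross c'), (p, .cross b'), (p + 1, .cross a')] s :=
  run_shift_congr (X := [(0, .cross a), (1, .cross b), (0, .cross c)])
    (Y := [(1, .cross c'), (0, .cross b'), (1, .cross a')]) (by simp) (by simp)
    (fun s => by rcases s with _ | ⟨x, _ | ⟨y, _ | ⟨z, s⟩⟩⟩ <;> simp [run, actAt, Piece.act]) p s

theorem Crossing.flip_flip (k : Crossing) : k.flip.flip = k := by
  cases k <;> rfl

namespace StackEquiv

variable {p q : ℕ}

theorem exchange_cross (c : Crossing) (g : Piece) (h : p + 2 ≤ q) (s : List Bool) :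
    StackEquiv s [(p, .cross c), (q, g)] [(q, g), (p, .cross c)] := by
  obtain ⟨r, rfl⟩ := Nat.exists_eq_add_of_le h
  exact .of_move (.inl (.exchange p r (.cross c) g)) (run_exchange p r (.cross c) g s)

theorem exchange_top (o : Bool) (g : Piece) (h : p ≤ q) (s : List Bool) :
    StackEquiv s [(p, .top o), (q + 2, g)] [(q, g), (p, .top o)] := by
  obtain ⟨r, rfl⟩ := Nat.exists_eq_add_of_le h
  rw [add_right_comm]
  exact .of_move (.inl (.exchange p r (.top o) g)) (run_exchange p r (.top o) g s)

theorem exchange_bot (g : Piece) (h : p ≤ q) (s : List Bool) :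
    StackEquiv s [(p, .bot), (q, g)] [(q + 2, g), (p, .bot)] := by
  obtain ⟨r, rfl⟩ := Nat.exists_eq_add_of_le h
  rw [add_right_comm]
  exact .of_move (.inl (.exchange p r .bot g)) (run_exchange p r .bot g s)

theorem pitchforkBot (p : ℕ) (k : Crossing) (s : List Bool) :
    StackEquiv s [(p, .cross k), (p + 1, .bot)] [(p + 1, .cross k.flip), (p, .bot)] :=
  .of_move (.inl (.pitchforkBot p k)) (run_pitchforkBot ..)

theorem pitchforkTop (p : ℕ) (o : Bool) (k : Crossing) (s : List Bool) :
    StackEquiv s [(p, .top o), (p + 1, .cross k)] [(p + 1, .top o), (p, .cross k.flip)] :=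
  .of_move (.inl (.pitchforkTop p o k)) (run_pitchforkTop ..)

theorem triangle {a b c : Crossing} (h : TriangleMove a b c) (p : ℕ) (s : List Bool) :
    StackEquiv s [(p, .cross a), (p + 1, .cross b), (p, .cross c)]
      [(p + 1, .cross c), (p, .cross b), (p + 1, .cross a)] :=
  .of_move (.inr (.three p a b c h)) (run_three ..)

end StackEquiv

/-! ### Sliding a double point along the arcs of a closure -/

/-- The maxima of the closure of a braid. -/
def tops (n : ℕ) : List Layer := (List.range n).map fun i => (i, Piece.top true)

/-- The minima of the closure of a braid. -/
def bots (n : ℕ) : List Layer := (List.range n).reverse.map fun i => (i, Piece.bot)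

theorem tops_succ (n : ℕ) : tops (n + 1) = tops n ++ [(n, Piece.top true)] := by
  simp [tops, List.range_succ]

theorem bots_succ (n : ℕ) : bots (n + 1) = (n, Piece.bot) :: bots n := by
  simp [bots, List.range_succ]

theorem closureLayers_eq {n : ℕ} (w : List (Letter n)) :
    closureLayers w = tops n ++ (w.map Letter.layer ++ bots n) := by
  simp [closureLayers, tops, bots]

theorem bots_slide {n i d : ℕ} (hn : n = i + d + 2) (k : Crossing) (s : List Bool) :
    StackEquiv s ((i, .cross k) :: bots n) ((i + 2 * d + 2, .cross k) :: bots n) := by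
  subst hn
  induction d generalizing s with
  | zero =>
    have slide (p : ℕ) (k : Crossing) (t : List Bool) :
        StackEquiv t ((p, .cross k) :: (p + 1, .bot) :: (i, .bot) :: bots i)
          ((p + 1, .cross k.flip) :: (p, .bot) :: (i, .bot) :: bots i) :=
      (StackEquiv.pitchforkBot p k t).append_right _
    rw [add_zero, mul_zero, add_zero, bots_succ, bots_succ]
    calc
      StackEquiv s ((i, .cross k) :: (i + 1, .bot) :: (i, .bot) :: bots i)
          ((i + 1, .cross k.flip) :: (i, .bot) :: (i, .bot) :: bots i) := slide i k s
      StackEquiv s _ ((i + 1, .cross k.flip) :: (i + 2, .bot) :: (i, .bot) :: bots i) :=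
        .cons _ fun t => (StackEquiv.exchange_bot .bot le_rfl t).append_right _
      StackEquiv s _ ((i + 2, .cross k) :: (i + 1, .bot) :: (i, .bot) :: bots i) := by
        simpa only [Crossing.flip_flip] using slide (i + 1) k.flip s
  | succ d ih =>
    rw [show i + (d + 1) + 2 = i + d + 2 + 1 by omega, bots_succ]
    calc
      StackEquiv s ((i, .cross k) :: (i + d + 2, .bot) :: bots (i + d + 2))
          ((i + d + 2, .bot) :: (i, .cross k) :: bots (i + d + 2)) :=
        (StackEquiv.exchange_cross k .bot (by omega) s).append_right _
      StackEquiv s _ ((i + d + 2, .bot) :: (i + 2 * d + 2, .cross k) :: bots (i + d + 2)) :=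
        .cons _ ih
      StackEquiv s _ ((i + 2 * (d + 1) + 2, .cross k) :: (i + d + 2, .bot) :: bots (i + d + 2)) :=
        (StackEquiv.exchange_bot (.cross k) (by omega) s).append_right _

theorem tops_slide {n i d : ℕ} (hn : n = i + d + 2) (k : Crossing) (L : List Layer)
    (s : List Bool) :
    StackEquiv s (tops n ++ (i, .cross k) :: L) (tops n ++ (i + 2 * d + 2, .cross k) :: L) := by
  subst hn
  induction d generalizing L with
  | zero =>
    have slide (p : ℕ) (k : Crossing) (t : List Bool) :
        StackEquiv t ((p + 1, .top true) :: (p, .cross k) :: L)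
          ((p, .top true) :: (p + 1, .cross k.flip) :: L) := by
      have h := (StackEquiv.pitchforkTop p true k.flip t).symm.append_right L
      rwa [Crossing.flip_flip] at h
    rw [add_zero, mul_zero, add_zero, tops_succ, tops_succ]
    simp only [List.append_assoc, List.cons_append, List.nil_append]
    refine .append_left (tops i) fun t _ => ?_
    calc
      StackEquiv t ((i, .top true) :: (i + 1, .top true) :: (i, .cross k) :: L)
          ((i, .top true) :: (i, .top true) :: (i + 1, .cross k.flip) :: L) :=
        .cons _ (slide i k)
      StackEquiv t _ ((i, .top true) :: (i + 2, .top true) :: (i + 1, .cross k.flip) :: L) :=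
        (StackEquiv.exchange_top true (.top true) le_rfl t).symm.append_right _
      StackEquiv t _ ((i, .top true) :: (i + 1, .top true) :: (i + 2, .cross k) :: L) :=
        .cons _ fun t => by simpa only [Crossing.flip_flip] using slide (i + 1) k.flip t
  | succ d ih =>
    rw [show i + (d + 1) + 2 = i + d + 2 + 1 by omega, tops_succ, List.append_assoc,
      List.append_assoc]
    calc
      StackEquiv s (tops (i + d + 2) ++ (i + d + 2, .top true) :: (i, .cross k) :: L)
          (tops (i + d + 2) ++ (i, .cross k) :: (i + d + 2, .top true) :: L) :=
        .append_left _ fun t _ =>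
          (StackEquiv.exchange_cross k (.top true) (by omega) t).symm.append_right _
      StackEquiv s _
          (tops (i + d + 2) ++ (i + 2 * d + 2, .cross k) :: (i + d + 2, .top true) :: L) := ih _
      StackEquiv s _
          (tops (i + d + 2) ++ (i + d + 2, .top true) :: (i + 2 * (d + 1) + 2, .cross k) :: L) :=
        .append_left _ fun t _ =>
          (StackEquiv.exchange_top true (.cross k) (by omega) t).symm.append_right _

theorem Letter.exists_layer_eq {n : ℕ} (l : Letter n) :
    ∃ (i : Fin (n - 1)) (c : Crossing), l.layer = (i.val, .cross c) := by
  cases l <;> exact ⟨_, _, rfl⟩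

theorem word_slide {n j : ℕ} (hj : n ≤ j) (g : Piece) (w : List (Letter n)) (s : List Bool) :
    StackEquiv s ((j, g) :: w.map Letter.layer) (w.map Letter.layer ++ [(j, g)]) := by
  induction w generalizing s with
  | nil => exact .refl _ _
  | cons l w ih =>
    have swap : StackEquiv s [(j, g), l.layer] [l.layer, (j, g)] := by
      obtain ⟨i, c, hl⟩ := l.exists_layer_eq
      rw [hl]
      exact (StackEquiv.exchange_cross c g (by omega) s).symm
    exact (swap.append_right _).trans (.cons _ ih)

theorem braidClosure_cons {n : ℕ} (l : Letter n) (w : List (Letter n)) :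
    FusedEquivalent (braidClosure (l :: w)) (braidClosure (w ++ [l])) := by
  obtain ⟨i, c, hl⟩ := l.exists_layer_eq
  obtain ⟨d, hd⟩ : ∃ d, n = i + d + 2 := ⟨n - i - 2, by omega⟩
  apply StackEquiv.fusedEquivalent_of_layers
  change StackEquiv [] (closureLayers (l :: w)) (closureLayers (w ++ [l]))
  rw [closureLayers_eq, closureLayers_eq, List.map_append, List.append_assoc, List.map_singleton,
    List.map_cons, hl]
  calc
    StackEquiv [] (tops n ++ (i.val, .cross c) :: (w.map Letter.layer ++ bots n))
        (tops n ++ (i + 2 * d + 2, .cross c) :: (w.map Letter.layer ++ bots n)) :=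
      tops_slide hd c _ _
    StackEquiv [] _ (tops n ++ (w.map Letter.layer ++ (i + 2 * d + 2, .cross c) :: bots n)) :=
      .append_left _ fun t _ => by
        simpa only [List.append_assoc, List.cons_append, List.nil_append] using
          (word_slide (by omega) (.cross c) w t).append_right (bots n)
    StackEquiv [] _ (tops n ++ (w.map Letter.layer ++ (i.val, .cross c) :: bots n)) :=
      .append_left _ fun _ _ => .append_left _ fun t _ => (bots_slide hd c t).symm

theorem braidClosure_append_comm {n : ℕ} (v w : List (Letter n)) :
    FusedEquivalent (braidClosure (v ++ w)) (braidClosure (w ++ v)) := by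
  induction v generalizing w with
  | nil => rw [List.append_nil]; exact .refl _
  | cons l v ih =>
    have rotate := braidClosure_cons l (v ++ w)
    have shorter := ih (w ++ [l])
    simp only [List.append_assoc, List.cons_append, List.nil_append] at rotate shorter ⊢
    exact rotate.trans _ _ _ shorter

/-! ### Virtual stabilization -/

/-- A letter on `n` strands, read as a letter on one strand more, added on the right. -/
def Letter.addStrand {n : ℕ} : Letter n → Letter (n + 1)
  | .sigma i => .sigma ⟨i, by omega⟩
  | .sigmaInv i => .sigmaInv ⟨i, by omega⟩
  | .rho i => .rho ⟨i, by omega⟩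

theorem Letter.layer_comp_addStrand {n : ℕ} :
    Letter.layer ∘ Letter.addStrand = (Letter.layer : Letter n → Layer) := by
  funext l
  cases l <;> rfl

theorem StackEquiv.kink (n : ℕ) (k : Crossing) (s : List Bool) :
    StackEquiv (List.replicate (n + 1) true ++ s)
      [(n + 1, .top true), (n, .cross k), (n + 1, .bot)] [] := by
  refine .of_move (.inr (.oneRight n true k)) ?_
  have h := run_shift_append (List.replicate n true) [(1, .top true), (0, .cross k), (1, .bot)]
    (true :: s)
  rw [List.length_replicate] at h
  rw [List.replicate_succ', List.append_assoc]
  exact h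

theorem braidClosure_stabilize {n : ℕ} (w : List (Letter n)) (k : Fin (n + 1 - 1))
    (hk : k.val + 1 = n) :
    FusedEquivalent (braidClosure w) (braidClosure (w.map Letter.addStrand ++ [.rho k])) := by
  have level : run (tops n ++ w.map Letter.layer) [] =
      some (List.replicate n true ++ List.replicate n false) := by
    rw [run_append, tops, run_tops, Option.bind_some, run_word]
  apply StackEquiv.fusedEquivalent_of_layers
  change StackEquiv [] (closureLayers _) (closureLayers _)
  rw [closureLayers_eq, closureLayers_eq, List.map_append, List.map_map,
    Letter.layer_comp_addStrand, tops_succ, bots_succ]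
  simp only [List.append_assoc]
  calc
    StackEquiv [] (tops n ++ (w.map Letter.layer ++ bots n)) (tops n ++ (w.map Letter.layer ++
        ([(n, .top true), (k.val, .cross .virt), (n, .bot)] ++ bots n))) := by
      simp only [← List.append_assoc (tops n)]
      refine .append_left _ fun t ht => (?_ : StackEquiv t [] _).append_right (bots n)
      obtain rfl := Option.some_injective _ (level.symm.trans ht)
      simpa only [hk] using (StackEquiv.kink k .virt _).symm
    StackEquiv [] _ (tops n ++ ([(n, .top true)] ++ (w.map Letter.layer ++
        ([(k.val, .cross .virt)] ++ (n, .bot) :: bots n)))) :=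
      .append_left _ fun t _ => by
        simpa only [List.append_assoc, List.cons_append, List.nil_append] using
          ((word_slide le_rfl (.top true) w t).append_right
            ((k.val, .cross .virt) :: (n, .bot) :: bots n)).symm

/-! ### Words that represent the same braid -/

namespace StackEquiv

theorem cross_flip {n : ℕ} (i : Fin (n - 1)) (c : Crossing) (s : List Bool) :
    StackEquiv (List.replicate n true ++ s) [(i.val, .cross c), (i.val, .cross c.flip)] [] :=
  .of_move (.inr (.two i c)) (by simp only [run, actAt_cross, Option.bind_some])

theorem cross_comm_of_far {m : ℕ} {i j : Fin m} (h : Far i j) (c d : Crossing) (s : List Bool) :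
    StackEquiv s [(i.val, .cross c), (j.val, .cross d)] [(j.val, .cross d), (i.val, .cross c)] :=
  h.elim (fun h => exchange_cross c _ h s) (fun h => (exchange_cross d _ h s).symm)

theorem triangle_of_succ {m : ℕ} {i j : Fin m} (hij : i.val + 1 = j.val) {a b c : Crossing}
    (h : TriangleMove a b c) (s : List Bool) :
    StackEquiv s [(i.val, .cross a), (j.val, .cross b), (i.val, .cross c)]
      [(j.val, .cross c), (i.val, .cross b), (j.val, .cross a)] := by
  rw [← hij]
  exact triangle h i s

end StackEquiv

/-- The congruence on braid words whose classes consist of words with equivalent stacks of layers,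
below any level that begins with `n` strands running downwards. -/
def wordCon (n : ℕ) : Con (FreeMonoid (Letter n)) where
  r v w := ∀ s, StackEquiv (List.replicate n true ++ s) (v.toList.map Letter.layer)
    (w.toList.map Letter.layer)
  iseqv := ⟨fun _ _ => .refl _ _, fun h s => (h s).symm, fun h h' s => (h s).trans (h' s)⟩
  mul' {v v' w w'} h h' s := by
    simp only [FreeMonoid.toList_mul, List.map_append]
    refine ((h s).append_right _).trans (.append_left _ fun t ht => ?_)
    rw [run_word, Option.some_inj] at ht
    exact ht ▸ h' s

/-- The class of a one-letter word modulo `wordCon`. -/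
def letterClass {n : ℕ} (l : Letter n) : (wordCon n).Quotient := (FreeMonoid.of l : FreeMonoid _)

/-- The class of a generator modulo `wordCon`, a unit by the second Reidemeister move. -/
def genUnit {n : ℕ} : Gen n → (wordCon n).Quotientˣ
  | .sigma i =>
    ⟨letterClass (.sigma i), letterClass (.sigmaInv i),
      (Con.eq (wordCon n)).2 (StackEquiv.cross_flip i .over),
      (Con.eq (wordCon n)).2 (StackEquiv.cross_flip i .under)⟩
  | .rho i =>
    ⟨letterClass (.rho i), letterClass (.rho i),
      (Con.eq (wordCon n)).2 (StackEquiv.cross_flip i .virt),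
      (Con.eq (wordCon n)).2 (StackEquiv.cross_flip i .virt)⟩

theorem lift_genUnit_eq_of_braidRel {n : ℕ} {x y : FreeGroup (Gen n)} (h : BraidRel n x y) :
    FreeGroup.lift genUnit x = FreeGroup.lift genUnit y := by
  apply Units.ext
  cases h <;> simp only [fs, fr, map_mul, FreeGroup.lift_apply_of, map_one] <;>
    refine (Con.eq (wordCon n)).2 fun s => ?_
  case b1 h =>
    exact .triangle_of_succ h (.classical .over .over .over trivial trivial trivial nofun) _
  case b2 h => exact .cross_comm_of_far h .over .over _
  case p1 h => exact .triangle_of_succ h .virtual _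
  case p2 h => exact .cross_comm_of_far h .virt .virt _
  case p3 i => exact .cross_flip i .virt s
  case m1 h => exact .cross_comm_of_far h .over .virt _
  case m2 h => exact .triangle_of_succ h (.mixed1 .over trivial) _
  case f1 h => exact .triangle_of_succ h (.forbidden3 .over trivial) _
  case f2 h => exact (StackEquiv.triangle_of_succ h (.forbidden1 .over trivial) _).symm

/-- The class modulo `wordCon` of the words that represent a braid. -/
def braidClass (n : ℕ) : UVB n →* (wordCon n).Quotientˣ :=
  PresentedGroup.toGroup (f := genUnit) (rels := braidRels n) (by
    rintro _ ⟨x, y, h, rfl⟩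
    rw [map_mul, map_inv, lift_genUnit_eq_of_braidRel h, mul_inv_cancel])

theorem braidClass_toUVB {n : ℕ} (l : Letter n) :
    (braidClass n l.toUVB : (wordCon n).Quotient) = letterClass l := by
  have of_gen (g : Gen n) : braidClass n (PresentedGroup.of g) = genUnit g :=
    PresentedGroup.toGroup.of _
  cases l with
  | sigma i => exact congrArg Units.val (of_gen (.sigma i))
  | sigmaInv i =>
    rw [Letter.toUVB, map_inv, sigma, of_gen]
    rfl
  | rho i => exact congrArg Units.val (of_gen (.rho i))

theorem braidOf_cons {n : ℕ} (l : Letter n) (w : List (Letter n)) :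
    braidOf (l :: w) = l.toUVB * braidOf w :=
  List.prod_cons

theorem braidClass_braidOf {n : ℕ} (w : List (Letter n)) :
    (braidClass n (braidOf w) : (wordCon n).Quotient) = (FreeMonoid.ofList w : FreeMonoid _) := by
  induction w with
  | nil => simp [braidOf]
  | cons l w ih =>
    rw [braidOf_cons, map_mul, Units.val_mul, ih, braidClass_toUVB]
    rfl

theorem braidClosure_congr {n : ℕ} {v w : List (Letter n)} (h : braidOf v = braidOf w) :
    FusedEquivalent (braidClosure v) (braidClosure w) := by
  have hvw : wordCon n (FreeMonoid.ofList v) (FreeMonoid.ofList w) :=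
    (Con.eq _).1 (by rw [← braidClass_braidOf, ← braidClass_braidOf, h])
  apply StackEquiv.fusedEquivalent_of_layers
  change StackEquiv [] (closureLayers _) (closureLayers _)
  rw [closureLayers_eq, closureLayers_eq]
  refine .append_left _ fun t ht => .append_right ?_ _
  obtain rfl := Option.some_injective _ ((run_tops n).symm.trans ht)
  exact hvw _

/-! ### Braids with equivalent closures -/

theorem braidOf_singleton {n : ℕ} (l : Letter n) : braidOf [l] = l.toUVB :=
  List.prod_singleton

theorem braidOf_append {n : ℕ} (v w : List (Letter n)) :
    braidOf (v ++ w) = braidOf v * braidOf w := by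
  simp [braidOf]

namespace ClosuresEquivalent

variable {l m n : ℕ}

theorem of_words {v : List (Letter m)} {w : List (Letter n)}
    (h : FusedEquivalent (braidClosure v) (braidClosure w)) :
    ClosuresEquivalent (braidOf v) (braidOf w) := fun _ _ ha hb =>
  (braidClosure_congr ha).trans _ _ _ (h.trans _ _ _ (braidClosure_congr hb.symm))

theorem refl (α : UVB n) : ClosuresEquivalent α α :=
  fun _ _ ha hb => braidClosure_congr (ha.trans hb.symm)

theorem symm {α : UVB m} {β : UVB n} (h : ClosuresEquivalent α β) : ClosuresEquivalent β α :=
  fun a b ha hb => (h b a hb ha).symm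

theorem trans {α : UVB l} {β : UVB m} {γ : UVB n} (h : ClosuresEquivalent α β)
    (h' : ClosuresEquivalent β γ) : ClosuresEquivalent α γ := by
  obtain ⟨w, hw⟩ := exists_braidOf β
  exact fun a b ha hb => (h a w ha hw).trans _ _ _ (h' w b hw hb)

instance : Trans (ClosuresEquivalent (m := l) (n := m)) (ClosuresEquivalent (m := m) (n := n))
    (ClosuresEquivalent (m := l) (n := n)) := ⟨trans⟩

theorem mul_comm (α β : UVB n) : ClosuresEquivalent (α * β) (β * α) := by
  obtain ⟨v, rfl⟩ := exists_braidOf α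
  obtain ⟨w, rfl⟩ := exists_braidOf β
  rw [← braidOf_append, ← braidOf_append]
  exact .of_words (braidClosure_append_comm v w)

theorem conj (α β : UVB n) : ClosuresEquivalent α (β * α * β⁻¹) := by
  simpa only [inv_mul_cancel_left] using mul_comm β⁻¹ (β * α)

end ClosuresEquivalent

theorem mk_eq_mk_of_braidRel {n : ℕ} {x y : FreeGroup (Gen n)} (h : BraidRel n x y) :
    PresentedGroup.mk (braidRels n) x = PresentedGroup.mk (braidRels n) y := by
  apply eq_of_mul_inv_eq_one
  rw [← map_inv, ← map_mul]
  exact (QuotientGroup.eq_one_iff _).2 (Subgroup.subset_normalClosure ⟨_, _, h, rfl⟩)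

/-- A generator of `UVB n`, read as a generator of `UVB (n + 1)`. -/
def Gen.addStrand {n : ℕ} : Gen n → Gen (n + 1)
  | .sigma i => .sigma ⟨i, by omega⟩
  | .rho i => .rho ⟨i, by omega⟩

/-- The inclusion of braids that adds a trivial strand on the right. -/
def addStrand {n : ℕ} : UVB n →* UVB (n + 1) :=
  PresentedGroup.toGroup (f := fun g => .of g.addStrand) (rels := braidRels n) (by
    rintro _ ⟨x, y, h, rfl⟩
    rw [map_mul, map_inv, mul_inv_eq_one]
    cases h <;> simp only [fs, fr, map_mul, FreeGroup.lift_apply_of, map_one, Gen.addStrand]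
    case b1 h => exact mk_eq_mk_of_braidRel (.b1 _ _ h)
    case b2 h => exact mk_eq_mk_of_braidRel (.b2 _ _ h)
    case p1 h => exact mk_eq_mk_of_braidRel (.p1 _ _ h)
    case p2 h => exact mk_eq_mk_of_braidRel (.p2 _ _ h)
    case p3 => exact mk_eq_mk_of_braidRel (.p3 _)
    case m1 h => exact mk_eq_mk_of_braidRel (.m1 _ _ h)
    case m2 h => exact mk_eq_mk_of_braidRel (.m2 _ _ h)
    case f1 h => exact mk_eq_mk_of_braidRel (.f1 _ _ h)
    case f2 h => exact mk_eq_mk_of_braidRel (.f2 _ _ h))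

section addStrand

variable {n : ℕ} {i : Fin (n - 1)} {j : Fin (n + 1 - 1)}

theorem addStrand_sigma (h : i.val = j.val) : addStrand (sigma i) = sigma j := by
  rw [show j = ⟨i, by omega⟩ from Fin.ext h.symm]
  exact PresentedGroup.toGroup.of _

theorem addStrand_rho (h : i.val = j.val) : addStrand (rho i) = rho j := by
  rw [show j = ⟨i, by omega⟩ from Fin.ext h.symm]
  exact PresentedGroup.toGroup.of _

theorem addStrand_lamUp (h : i.val = j.val) : addStrand (lamUp i) = lamUp j := by
  rw [lamUp, lamUp, map_mul, map_inv, addStrand_rho h, addStrand_sigma h]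

theorem addStrand_lamDown (h : i.val = j.val) : addStrand (lamDown i) = lamDown j := by
  rw [lamDown, lamDown, map_mul, map_mul, addStrand_rho h, addStrand_lamUp h]

end addStrand

theorem braidOf_map_addStrand {n : ℕ} (w : List (Letter n)) :
    braidOf (w.map Letter.addStrand) = addStrand (braidOf w) := by
  rw [braidOf, braidOf, map_list_prod, List.map_map, List.map_map]
  congr 2
  funext l
  cases l with
  | sigma i => exact (addStrand_sigma rfl).symm
  | sigmaInv i => exact ((map_inv addStrand _).trans (congrArg _ (addStrand_sigma rfl))).symm
  | rho i => exact (addStrand_rho rfl).symm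

theorem closuresEquivalent_stabilize {n : ℕ} {k : Fin (n + 1 - 1)} (hk : k.val + 1 = n)
    (α : UVB n) : ClosuresEquivalent α (addStrand α * rho k) := by
  obtain ⟨w, rfl⟩ := exists_braidOf α
  have h := ClosuresEquivalent.of_words (braidClosure_stabilize w k hk)
  rwa [braidOf_append, braidOf_map_addStrand, braidOf_singleton] at h

theorem closuresEquivalent_mul_stabilize {n : ℕ} {k : Fin (n + 1 - 1)} (hk : k.val + 1 = n)
    (α β γ : UVB n) :
    ClosuresEquivalent (α * β)
      (addStrand α * (addStrand γ * rho k * (addStrand γ)⁻¹) * addStrand β) := by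
  calc
    ClosuresEquivalent (α * β) (β * α) := .mul_comm α β
    ClosuresEquivalent _ (γ⁻¹ * (β * α) * γ⁻¹⁻¹) := .conj _ _
    ClosuresEquivalent _ (addStrand (γ⁻¹ * (β * α) * γ⁻¹⁻¹) * rho k) :=
      closuresEquivalent_stabilize hk _
    ClosuresEquivalent _ _ := .conj _ ((addStrand β)⁻¹ * addStrand γ)
    _ = _ := by simp only [map_mul, map_inv]; group

/-! ### Commuting pure generators -/

section Group

variable {G : Type*} [Group G] {a q u v x x' y y' : G}

theorem commute_of_semiconjBy (hx : SemiconjBy a x x') (hy : SemiconjBy a y y')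
    (h : Commute x y) : Commute x' y' := by
  have conj := h.conj a
  rwa [hx.eq, hy.eq, mul_inv_cancel_right, mul_inv_cancel_right] at conj

theorem commute_of_semiconjBy_mul_left (haq : SemiconjBy (a * q) u v) (ha : SemiconjBy a u v) :
    Commute q u :=
  mul_left_cancel (a := a) (by rw [← mul_assoc, haq.eq, ← mul_assoc, ← mul_assoc, ha.eq])

end Group

section PureGenerators

variable {n : ℕ} {i j k : Fin (n - 1)}

theorem rho_mul_self (i : Fin (n - 1)) : rho i * rho i = 1 := mk_eq_mk_of_braidRel (.p3 i)

theorem rho_inv (i : Fin (n - 1)) : (rho i)⁻¹ = rho i :=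
  inv_eq_of_mul_eq_one_left (rho_mul_self i)

theorem rho_braid (h : i.val + 1 = j.val) : rho i * rho j * rho i = rho j * rho i * rho j :=
  mk_eq_mk_of_braidRel (.p1 i j h)

theorem rho_commute_rho (h : Far i j) : Commute (rho i) (rho j) :=
  mk_eq_mk_of_braidRel (.p2 i j h)

theorem semiconjBy_rho (i : Fin (n - 1)) (x : UVB n) :
    SemiconjBy (rho i) x (rho i * x * rho i) := by
  rw [SemiconjBy, mul_assoc, rho_mul_self, mul_one]

theorem semiconjBy_rho_comm {x y : UVB n} : SemiconjBy (rho i) x y ↔ SemiconjBy (rho i) y x := by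
  rw [← SemiconjBy.inv_symm_left_iff, rho_inv]

theorem sigma_inv_eq (i : Fin (n - 1)) : (sigma i)⁻¹ = rho i * lamUp i := by
  rw [lamUp, ← mul_assoc, rho_mul_self, one_mul]

/-- For `j` the successor of `i`, the pure generator `λ_{i,i+2}`, numbered as
in `lamUp`. -/
def lamSkip (i j : Fin (n - 1)) : UVB n := rho j * lamUp i * rho j

theorem rho_mul_rho_semiconjBy_rho (h : i.val + 1 = j.val) :
    SemiconjBy (rho i * rho j) (rho i) (rho j) := by
  rw [SemiconjBy, rho_braid h, mul_assoc]

theorem rho_mul_rho_semiconjBy_lamUp (h : i.val + 1 = j.val) :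
    SemiconjBy (rho i * rho j) (lamUp i) (lamUp j) := by
  have sigma_semiconj : SemiconjBy (rho i * rho j) (sigma i) (sigma j) := by
    rw [SemiconjBy, ← mul_assoc]
    exact mk_eq_mk_of_braidRel (.m2 i j h)
  exact (rho_mul_rho_semiconjBy_rho h).mul_right sigma_semiconj.inv_right

theorem rho_mul_rho_semiconjBy_lamDown (h : i.val + 1 = j.val) :
    SemiconjBy (rho i * rho j) (lamDown i) (lamDown j) :=
  ((rho_mul_rho_semiconjBy_rho h).mul_right (rho_mul_rho_semiconjBy_lamUp h)).mul_right
    (rho_mul_rho_semiconjBy_rho h)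

theorem rho_semiconjBy_lamSkip (h : i.val + 1 = j.val) :
    SemiconjBy (rho i) (lamSkip i j) (lamUp j) := by
  have := (rho_mul_rho_semiconjBy_lamUp h).mul_left (semiconjBy_rho_comm.1 (semiconjBy_rho j _))
  rwa [mul_assoc, rho_mul_self, mul_one] at this

theorem sigma_inv_mul_sigma_inv (i j : Fin (n - 1)) :
    (sigma i)⁻¹ * (sigma j)⁻¹ = rho i * rho j * (lamSkip i j * lamUp j) := by
  have swap : rho j * lamSkip i j = lamUp i * rho j :=
    semiconjBy_rho_comm.1 (semiconjBy_rho j (lamUp i))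
  rw [sigma_inv_eq, sigma_inv_eq, mul_assoc (rho i), mul_assoc (rho i), ← mul_assoc (rho j),
    swap, mul_assoc]

theorem sigma_succ_inv_mul_sigma_inv (h : i.val + 1 = j.val) :
    (sigma j)⁻¹ * (sigma i)⁻¹ = rho j * rho i * (lamSkip i j * lamUp i) := by
  rw [sigma_inv_eq, sigma_inv_eq, mul_assoc (rho j), mul_assoc (rho j), ← mul_assoc (rho i),
    (rho_semiconjBy_lamSkip h).eq, mul_assoc]

theorem lamSkip_mul_lamUp_succ_commute_rho (h : i.val + 1 = j.val) :
    Commute (lamSkip i j * lamUp j) (rho i) := by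
  have forbidden : SemiconjBy (sigma j * sigma i) (rho j) (rho i) := by
    rw [SemiconjBy, ← mul_assoc]
    exact (mk_eq_mk_of_braidRel (.f1 i j h)).symm
  have := forbidden.inv_symm_left
  rw [mul_inv_rev, sigma_inv_mul_sigma_inv] at this
  exact commute_of_semiconjBy_mul_left this (rho_mul_rho_semiconjBy_rho h)

theorem lamSkip_mul_lamUp_commute_rho_succ (h : i.val + 1 = j.val) :
    Commute (lamSkip i j * lamUp i) (rho j) := by
  have forbidden : SemiconjBy (sigma i * sigma j) (rho i) (rho j) := by
    rw [SemiconjBy, ← mul_assoc]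
    exact (mk_eq_mk_of_braidRel (.f2 i j h)).symm
  have := forbidden.inv_symm_left
  rw [mul_inv_rev, sigma_succ_inv_mul_sigma_inv h] at this
  have rho_swap : SemiconjBy (rho j * rho i) (rho j) (rho i) := by
    rw [SemiconjBy, ← rho_braid h, mul_assoc]
  exact commute_of_semiconjBy_mul_left this rho_swap

theorem lamUp_commute_lamUp_succ (h : i.val + 1 = j.val) : Commute (lamUp i) (lamUp j) := by
  have sigma_braid : sigma i * sigma j * sigma i = sigma j * sigma i * sigma j :=
    mk_eq_mk_of_braidRel (.b1 i j h)
  have : rho i * rho j * rho i * (lamSkip i j * (lamUp j * lamUp i)) =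
      rho i * rho j * rho i * (lamSkip i j * (lamUp i * lamUp j)) := by
    calc
      _ = rho i * rho j * (rho i * (lamSkip i j * lamUp j)) * lamUp i := by
        simp only [mul_assoc]
      _ = rho i * rho j * (lamSkip i j * lamUp j) * (rho i * lamUp i) := by
        rw [← (lamSkip_mul_lamUp_succ_commute_rho h).eq]
        simp only [mul_assoc]
      _ = (sigma i * sigma j * sigma i)⁻¹ := by
        rw [← sigma_inv_mul_sigma_inv, ← sigma_inv_eq, mul_inv_rev, mul_inv_rev, mul_assoc]
      _ = (sigma j * sigma i * sigma j)⁻¹ := by rw [sigma_braid]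
      _ = rho j * rho i * (lamSkip i j * lamUp i) * (rho j * lamUp j) := by
        rw [← sigma_succ_inv_mul_sigma_inv h, ← sigma_inv_eq, mul_inv_rev, mul_inv_rev, mul_assoc]
      _ = rho j * rho i * (rho j * (lamSkip i j * lamUp i)) * lamUp j := by
        rw [← (lamSkip_mul_lamUp_commute_rho_succ h).eq]
        simp only [mul_assoc]
      _ = _ := by
        rw [rho_braid h]
        simp only [mul_assoc]
  exact (mul_left_cancel (mul_left_cancel this)).symm

theorem lamDown_commute_lamSkip (h : i.val + 1 = j.val) : Commute (lamDown i) (lamSkip i j) :=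
  commute_of_semiconjBy (semiconjBy_rho i _) (semiconjBy_rho_comm.1 (rho_semiconjBy_lamSkip h))
    (lamUp_commute_lamUp_succ h)

theorem lamUp_commute_rho_of_far (h : Far i j) : Commute (lamUp i) (rho j) := by
  have sigma_commute : Commute (sigma i) (rho j) := mk_eq_mk_of_braidRel (.m1 i j h)
  exact (rho_commute_rho h).mul_left sigma_commute.inv_left

theorem lamUp_commute_lamUp_of_far (h : Far i j) : Commute (lamUp i) (lamUp j) := by
  have rho_commute : Commute (rho i) (sigma j) :=
    Commute.symm (mk_eq_mk_of_braidRel (.m1 j i (Or.symm h)))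
  have sigma_commute : Commute (sigma i) (sigma j) := mk_eq_mk_of_braidRel (.b2 i j h)
  exact (lamUp_commute_rho_of_far h).mul_right
    (rho_commute.mul_left sigma_commute.inv_left).inv_right

theorem far_of_succ_succ (hij : i.val + 1 = j.val) (hjk : j.val + 1 = k.val) : Far i k :=
  .inl (by omega)

theorem lamSkip_commute_lamSkip_succ (hij : i.val + 1 = j.val) (hjk : j.val + 1 = k.val) :
    Commute (lamSkip i j) (lamSkip j k) :=
  commute_of_semiconjBy (semiconjBy_rho j _) (semiconjBy_rho_comm.1 (rho_semiconjBy_lamSkip hjk))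
    (lamUp_commute_lamUp_of_far (far_of_succ_succ hij hjk))

end PureGenerators

/-! ### Exchanging the pure generators of the last two strands -/

section FourStrands

variable {n : ℕ} {i j k : Fin (n - 1)}

/-- For `j` the successor of `i`, the element of the symmetric group inside `UVB n` that exchanges
the strands `i` and `i + 2`. -/
def rhoSkip (i j : Fin (n - 1)) : UVB n := rho i * rho j * rho i

theorem rhoSkip_semiconjBy_lamUp_lamDown (h : i.val + 1 = j.val) :
    SemiconjBy (rhoSkip i j) (lamUp j) (lamDown i) :=
  ((semiconjBy_rho i _).mul_left (semiconjBy_rho_comm.1 (semiconjBy_rho j _))).mul_left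
    (semiconjBy_rho_comm.1 (rho_semiconjBy_lamSkip h))

theorem rhoSkip_semiconjBy_lamUp (hij : i.val + 1 = j.val) (hjk : j.val + 1 = k.val) :
    SemiconjBy (rhoSkip j k) (rho k * lamSkip i j * rho k) (lamUp i) := by
  rw [rhoSkip, rho_braid hjk]
  have rho_commute : Commute (rho k) (lamUp i) :=
    (lamUp_commute_rho_of_far (far_of_succ_succ hij hjk)).symm
  exact (rho_commute.semiconjBy.mul_left (semiconjBy_rho_comm.1 (semiconjBy_rho j _))).mul_left
    (semiconjBy_rho_comm.1 (semiconjBy_rho k _))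

theorem rho_conj_rhoSkip_semiconjBy_lamDown (hij : i.val + 1 = j.val)
    (hjk : j.val + 1 = k.val) :
    SemiconjBy (rho i * rhoSkip j k * rho i) (lamSkip j k) (lamDown i) := by
  have hik : SemiconjBy (rho i) (rho k) (rho k) := rho_commute_rho (far_of_succ_succ hij hjk)
  have lamSkip_semiconj : SemiconjBy (rho i) (lamSkip j k) (rho k * lamSkip i j * rho k) :=
    (hik.mul_right (semiconjBy_rho_comm.1 (rho_semiconjBy_lamSkip hij))).mul_right hik
  exact ((semiconjBy_rho i _).mul_left (rhoSkip_semiconjBy_lamUp hij hjk)).mul_left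
    lamSkip_semiconj

theorem rho_conj_rhoSkip_succ (hij : i.val + 1 = j.val) (hjk : j.val + 1 = k.val) :
    rho i * rhoSkip j k * rho i = rho k * rhoSkip i j * rho k := by
  have hik : rho i * rho k = rho k * rho i := rho_commute_rho (far_of_succ_succ hij hjk)
  rw [rhoSkip, rho_braid hjk, rhoSkip]
  calc
    _ = (rho i * rho k) * rho j * (rho k * rho i) := by simp only [mul_assoc]
    _ = (rho k * rho i) * rho j * (rho i * rho k) := by rw [hik]
    _ = _ := by simp only [mul_assoc]

theorem rhoSkip_commute_rhoSkip_succ (hij : i.val + 1 = j.val) (hjk : j.val + 1 = k.val) :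
    Commute (rhoSkip i j) (rhoSkip j k) := by
  have hik : SemiconjBy (rho i) (rho k) (rho k) := rho_commute_rho (far_of_succ_succ hij hjk)
  rw [rhoSkip, rho_braid hij]
  exact ((semiconjBy_rho j _).mul_left hik).mul_left (semiconjBy_rho_comm.1 (semiconjBy_rho j _))

theorem rho_mul_rho_mul_conj_rhoSkip (hij : i.val + 1 = j.val) (hjk : j.val + 1 = k.val) :
    rho k * rho j * (rho i * rhoSkip j k * rho i) * rho k = rhoSkip i j * rhoSkip j k := by
  rw [rho_conj_rhoSkip_succ hij hjk, (rhoSkip_commute_rhoSkip_succ hij hjk).eq]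
  calc
    _ = rho k * rho j * rho k * rhoSkip i j * (rho k * rho k) := by simp only [mul_assoc]
    _ = _ := by rw [rho_mul_self, mul_one, ← rho_braid hjk, ← rhoSkip]

theorem rho_conj_mul_eq (hij : i.val + 1 = j.val) (hjk : j.val + 1 = k.val) {b : UVB n}
    (hb : Commute b (rho k)) :
    rho k * (b * (rho j * lamDown i) * (rho i * rhoSkip j k * rho i) * lamSkip i j) * rho k =
      b * (rhoSkip i j * lamUp i) * rhoSkip j k * lamUp j := by
  have lamSkip_rho : lamSkip j k * rho k = rho k * lamUp j := (semiconjBy_rho k (lamUp j)).symm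
  have rho_lamSkip : lamSkip i j * rho k = rho k * (rho k * lamSkip i j * rho k) :=
    (semiconjBy_rho_comm.1 (semiconjBy_rho k (lamSkip i j))).symm
  generalize ht : rho i * rhoSkip j k * rho i = t
  have lamDown_t : lamDown i * t = t * lamSkip j k :=
    ht ▸ (rho_conj_rhoSkip_semiconjBy_lamDown hij hjk).symm
  calc
    _ = b * rho k * rho j * (lamDown i * t) * lamSkip i j * rho k := by
      rw [hb.eq]
      simp only [mul_assoc]
    _ = b * rho k * rho j * t * (lamSkip i j * lamSkip j k) * rho k := by
      rw [lamDown_t, (lamSkip_commute_lamSkip_succ hij hjk).eq]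
      simp only [mul_assoc]
    _ = b * rho k * rho j * t * (lamSkip i j * rho k) * lamUp j := by
      simp only [mul_assoc, lamSkip_rho]
    _ = b * (rho k * rho j * t * rho k) * (rho k * lamSkip i j * rho k) * lamUp j := by
      rw [rho_lamSkip]
      simp only [mul_assoc]
    _ = b * rhoSkip i j * (rhoSkip j k * (rho k * lamSkip i j * rho k)) * lamUp j := by
      rw [← ht, rho_mul_rho_mul_conj_rhoSkip hij hjk]
      simp only [mul_assoc]
    _ = _ := by
      rw [(rhoSkip_semiconjBy_lamUp hij hjk).eq]
      simp only [mul_assoc]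

end FourStrands

section Stabilize

variable {n : ℕ} {i₀ : Fin (n - 1)} {i j : Fin (n + 1 - 1)}

theorem addStrand_lamSkip {j₀ : Fin (n - 1)} (hi : i₀.val = i.val) (hj : j₀.val = j.val) :
    addStrand (lamSkip i₀ j₀) = lamSkip i j := by
  rw [lamSkip, lamSkip, map_mul, map_mul, addStrand_rho hj, addStrand_lamUp hi]

theorem addStrand_rhoSkip {j₀ : Fin (n - 1)} (hi : i₀.val = i.val) (hj : j₀.val = j.val) :
    addStrand (rhoSkip i₀ j₀) = rhoSkip i j := by
  rw [rhoSkip, rhoSkip, map_mul, map_mul, addStrand_rho hj, addStrand_rho hi]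

theorem addStrand_addStrand_commute_rho (β : UVB n) {k : Fin (n + 2 - 1)} (hk : k.val = n) :
    Commute (addStrand (addStrand β)) (rho k) := by
  have hβ : β ∈ Subgroup.closure (Set.range (PresentedGroup.of (rels := braidRels n))) := by
    simp
  induction hβ using Subgroup.closure_induction with
  | mem x hx =>
    obtain ⟨g | g, rfl⟩ := hx
    · rw [← sigma, addStrand_sigma (n := n) (j := ⟨g, by omega⟩) rfl,
        addStrand_sigma (n := n + 1) (j := ⟨g, by omega⟩) rfl]
      exact mk_eq_mk_of_braidRel (.m1 _ _ (.inl (by simp only; omega)))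
    · rw [← rho, addStrand_rho (n := n) (j := ⟨g, by omega⟩) rfl,
        addStrand_rho (n := n + 1) (j := ⟨g, by omega⟩) rfl]
      exact rho_commute_rho (.inl (by simp only; omega))
  | one => simp only [map_one, Commute.one_left]
  | mul x y _ _ hx hy => simpa only [map_mul] using hx.mul_left hy
  | inv x _ hx => simpa only [map_inv] using hx.inv_left

theorem closuresEquivalent_lamUp_mul_lamDown (hi : i₀.val = i.val) (hij : i.val + 1 = j.val)
    (hj : j.val + 1 = n) (β : UVB n) :
    ClosuresEquivalent (β * (lamUp i₀ * lamDown i₀))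
      (addStrand β * (rho j * lamDown i) * lamSkip i j) := by
  have h := closuresEquivalent_mul_stabilize hj (β * lamUp i₀) (lamDown i₀) 1
  rw [map_one, inv_one, one_mul, mul_one, map_mul, addStrand_lamUp hi, addStrand_lamDown hi,
    mul_assoc β, mul_assoc (addStrand β), ← (semiconjBy_rho_comm.1 (semiconjBy_rho j _)).eq] at h
  convert h using 1
  change _ = addStrand β * (rho j * lamSkip i j) * lamDown i
  simp only [mul_assoc, (lamDown_commute_lamSkip hij).eq]

theorem closuresEquivalent_lamDown_mul_lamUp (hi : i₀.val = i.val) (hij : i.val + 1 = j.val)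
    (hj : j.val + 1 = n) (β : UVB n) :
    ClosuresEquivalent (β * (lamDown i₀ * lamUp i₀))
      (addStrand β * (rhoSkip i j * lamUp i) * lamUp j) := by
  have h := closuresEquivalent_mul_stabilize hj (β * lamDown i₀) (lamUp i₀) (rho i₀)
  rw [map_mul, addStrand_lamUp hi, addStrand_lamDown hi, addStrand_rho hi, rho_inv, ← rhoSkip,
    mul_assoc β, mul_assoc (addStrand β), ← (rhoSkip_semiconjBy_lamUp_lamDown hij).eq] at h
  simpa only [mul_assoc, (lamUp_commute_lamUp_succ hij).eq] using h

theorem lamUp_mul_lamDown_last_closuresEquivalent (hi : i₀.val + 2 = n) (β : UVB n) :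
    ClosuresEquivalent (β * (lamUp i₀ * lamDown i₀)) (β * (lamDown i₀ * lamUp i₀)) := by
  let i₁ : Fin (n + 1 - 1) := ⟨i₀, by omega⟩
  let j₁ : Fin (n + 1 - 1) := ⟨i₀ + 1, by omega⟩
  let i : Fin (n + 2 - 1) := ⟨i₀, by omega⟩
  let j : Fin (n + 2 - 1) := ⟨i₀ + 1, by omega⟩
  let k : Fin (n + 2 - 1) := ⟨i₀ + 2, by omega⟩
  have hb : Commute (addStrand (addStrand β)) (rho k) := addStrand_addStrand_commute_rho β hi
  have hA := closuresEquivalent_mul_stabilize (k := k) (by simp only [k]; omega)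
    (addStrand β * (rho j₁ * lamDown i₁)) (lamSkip i₁ j₁) (rho i₁ * rho j₁)
  have hB := closuresEquivalent_mul_stabilize (k := k) (by simp only [k]; omega)
    (addStrand β * (rhoSkip i₁ j₁ * lamUp i₁)) (lamUp j₁) (rho j₁)
  simp only [map_mul, addStrand_rho (i := i₁) (j := i) rfl, mul_inv_rev, rho_inv,
    addStrand_rho (i := j₁) (j := j) rfl, addStrand_lamUp (i := i₁) (j := i) rfl,
    addStrand_lamUp (i := j₁) (j := j) rfl, addStrand_lamDown (i := i₁) (j := i) rfl] at hA hB
  rw [addStrand_lamSkip (i := i) (j := j) rfl rfl] at hA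
  rw [addStrand_rhoSkip (i := i) (j := j) rfl rfl, ← rhoSkip] at hB
  have conj := ClosuresEquivalent.conj (addStrand (addStrand β) * (rho j * lamDown i) *
    (rho i * rhoSkip j k * rho i) * lamSkip i j) (rho k)
  rw [rho_inv, rho_conj_mul_eq rfl rfl hb] at conj
  calc
    ClosuresEquivalent (β * (lamUp i₀ * lamDown i₀))
        (addStrand β * (rho j₁ * lamDown i₁) * lamSkip i₁ j₁) :=
      closuresEquivalent_lamUp_mul_lamDown rfl rfl hi β
    ClosuresEquivalent _ (addStrand (addStrand β) * (rho j * lamDown i) *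
        (rho i * rhoSkip j k * rho i) * lamSkip i j) := by
      simpa only [rhoSkip, mul_assoc] using hA
    ClosuresEquivalent _ (addStrand (addStrand β) * (rhoSkip i j * lamUp i) * rhoSkip j k *
        lamUp j) := conj
    ClosuresEquivalent _ (addStrand β * (rhoSkip i₁ j₁ * lamUp i₁) * lamUp j₁) := hB.symm
    ClosuresEquivalent _ (β * (lamDown i₀ * lamUp i₀)) :=
      (closuresEquivalent_lamDown_mul_lamUp rfl rfl hi β).symm

end Stabilize

/-! ### Factors that may replace each other -/

/-- The congruence of braids that may replace each other as factors of any braid without changing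
the fused link that its closure represents. -/
def factorCon (n : ℕ) : Con (UVB n) where
  r g h := ∀ β, ClosuresEquivalent (β * g) (β * h)
  iseqv := ⟨fun _ _ => .refl _, fun h β => (h β).symm, fun h h' β => (h β).trans (h' β)⟩
  mul' {g g' h h'} hg hh β := by
    calc
      ClosuresEquivalent (β * (g * h)) (h * β * g) := by
        simpa only [mul_assoc] using ClosuresEquivalent.mul_comm (β * g) h
      ClosuresEquivalent _ (h * β * g') := hg _
      ClosuresEquivalent _ (β * g' * h) := by
        simpa only [mul_assoc] using ClosuresEquivalent.mul_comm h (β * g')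
      ClosuresEquivalent _ (β * g' * h') := hh _
      _ = β * (g' * h') := mul_assoc _ _ _

theorem factorCon_mk_lamUp_commute_lamDown {n : ℕ} (i : Fin (n - 1)) :
    Commute ((factorCon n).mk' (lamUp i)) ((factorCon n).mk' (lamDown i)) := by
  obtain ⟨d, hd⟩ : ∃ d, i + d + 2 = n := ⟨n - i - 2, by omega⟩
  induction d generalizing i with
  | zero => exact (Con.eq _).2 (lamUp_mul_lamDown_last_closuresEquivalent hd)
  | succ d ih =>
    have hi : i.val + 1 = (⟨i + 1, by omega⟩ : Fin (n - 1)).val := rfl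
    exact commute_of_semiconjBy
      ((rho_mul_rho_semiconjBy_lamUp hi).inv_symm_left.map (factorCon n).mk')
      ((rho_mul_rho_semiconjBy_lamDown hi).inv_symm_left.map (factorCon n).mk')
      (ih _ (by simp only; omega))

theorem map_commute_of_mem_closure {G H : Type*} [Group G] [Group H] (f : G →* H) {S : Set G}
    (hS : ∀ x ∈ S, ∀ y ∈ S, Commute (f x) (f y)) {u v : G} (hu : u ∈ Subgroup.closure S)
    (hv : v ∈ Subgroup.closure S) : Commute (f u) (f v) := by
  have image_commutes : IsMulCommutative (Subgroup.closure (f '' S)) := by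
    apply Subgroup.isMulCommutative_closure
    rintro _ ⟨x, hx, rfl⟩ _ ⟨y, hy, rfl⟩
    exact hS x hx y hy
  rw [← MonoidHom.map_closure] at image_commutes
  exact setLike_mul_comm (Subgroup.mem_map_of_mem f hu) (Subgroup.mem_map_of_mem f hv)

end FusedLinks

open FusedLinks in
theorem mainTheorem4_general {n : ℕ} (i : Fin (n - 1)) (α : UVB n) {u v : UVB n}
    (hu : u ∈ Subgroup.closure {lamUp i, lamDown i})
    (hv : v ∈ Subgroup.closure {lamUp i, lamDown i}) :
    ClosuresEquivalent α (α * (u⁻¹ * v⁻¹ * u * v)) := by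
  let f := (factorCon n).mk'
  have generators_commute : Commute (f (lamUp i)) (f (lamDown i)) :=
    factorCon_mk_lamUp_commute_lamDown i
  have commute_uv : Commute (f u) (f v) := by
    refine map_commute_of_mem_closure f ?_ hu hv
    rintro x (rfl | rfl) y (rfl | rfl)
    exacts [.refl _, generators_commute, generators_commute.symm, .refl _]
  have commutator_eq_one : f 1 = f (u⁻¹ * v⁻¹ * u * v) := by
    rw [map_mul, map_mul, map_mul, map_inv, map_inv, map_one, mul_assoc, commute_uv.eq]
    group
  simpa only [mul_one] using (Con.eq (factorCon n)).1 commutator_eq_one α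

theorem mainTheorem4 (n : ℕ) (hn : 2 ≤ n) (α u v : FusedLinks.UVB n)
    (hα : α ∈ FusedLinks.UVP n)
    (hu : u ∈ Subgroup.closure
      {FusedLinks.lamUp (n := n) ⟨n - 2, by omega⟩, FusedLinks.lamDown (n := n) ⟨n - 2, by omega⟩})
    (hv : v ∈ Subgroup.closure
      {FusedLinks.lamUp (n := n) ⟨n - 2, by omega⟩, FusedLinks.lamDown (n := n) ⟨n - 2, by omega⟩}) :
    FusedLinks.ClosuresEquivalent α (α * (u⁻¹ * v⁻¹ * u * v)) :=
  mainTheorem4_general _ α hu hv
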